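/- Let $P$ be a partially ordered set with a least and a greatest element. For a lattice $L$ let $\operatorname{Princ} L$ denote the set of principal congruences of $L$ (the congruences $\operatorname{con}(a,b)$, where $a,b\in L$ and $\operatorname{con}(a,b)$ is the least lattice congruence of $L$ that identifies $a$ and $b$), ordered by inclusion. Then there is a bounded lattice $K$ with the following properties. 1. $P\cong\operatorname{Princ} K$ as ordered sets. 2. If $P$ is finite, then $K$ is finite. 3. $K$ has length at most $5$ (every chain of $K$ has at most $6$ elements), and $K$ has length exactly $5$ if $P$ has more than one element. 4. $K$ is a complete lattice, and every congruence of $K$ is complete, that is, compatible with joins and meets of arbitrary families. 5. $P$ is also isomorphic to the set of principal complete congruences of $K$ (the least complete congruences identifying $a$ and $b$, for $a,b\in K$), ordered by inclusion. -/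

import Mathlib

universe u

namespace LatticeCon

section Lattice

variable {α : Type u} [Lattice α]

theorem toSetoid_injective :
    Function.Injective (LatticeCon.toSetoid : LatticeCon α → Setoid α) := by
  rintro ⟨s, _, _⟩ ⟨t, _, _⟩ h
  cases h
  rfl

/-- Lattice congruences are ordered by inclusion of relations:
`c ≤ d` means that `c.r x y` implies `d.r x y`. -/
instance : PartialOrder (LatticeCon α) :=
  PartialOrder.lift LatticeCon.toSetoid toSetoid_injective

theorem le_iff {c d : LatticeCon α} : c ≤ d ↔ ∀ x y : α, c.r x y → d.r x y :=
  ⟨fun h _ _ hxy => h hxy, fun h x y hxy => h x y hxy⟩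

/-- The intersection of a set of lattice congruences. -/
def inter (C : Set (LatticeCon α)) : LatticeCon α where
  r x y := ∀ c ∈ C, c.r x y
  iseqv :=
    { refl := fun x c _ => c.refl x
      symm := fun h c hc => c.symm (h c hc)
      trans := fun h₁ h₂ c hc => c.trans (h₁ c hc) (h₂ c hc) }
  inf h₁ h₂ c hc := c.inf (h₁ c hc) (h₂ c hc)
  sup h₁ h₂ c hc := c.sup (h₁ c hc) (h₂ c hc)

/-- The principal congruence `con(a, b)`: the least lattice congruence that identifies
`a` and `b`. -/
def principal (a b : α) : LatticeCon α :=
  inter {c | c.r a b}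

theorem isLeast_principal (a b : α) : IsLeast {c : LatticeCon α | c.r a b} (principal a b) :=
  ⟨fun _ hc => hc, fun c hc => le_iff.2 fun _ _ h => h c hc⟩

end Lattice

section CompleteLattice

variable {α : Type u} [CompleteLattice α]

/-- A lattice congruence of a complete lattice is complete if it is compatible with arbitrary
joins and meets. A family of congruent pairs `(xᵢ, yᵢ)` is given as the set `S` of these pairs. -/
def IsComplete (c : LatticeCon α) : Prop :=
  ∀ S : Set (α × α), (∀ p ∈ S, c.r p.1 p.2) →
    c.r (⨆ p ∈ S, p.1) (⨆ p ∈ S, p.2) ∧ c.r (⨅ p ∈ S, p.1) (⨅ p ∈ S, p.2)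

/-- The principal complete congruence generated by `(a, b)`: the least complete congruence that
identifies `a` and `b`. -/
def completePrincipal (a b : α) : LatticeCon α :=
  inter {c | c.IsComplete ∧ c.r a b}

theorem isLeast_completePrincipal (a b : α) :
    IsLeast {c : LatticeCon α | c.IsComplete ∧ c.r a b} (completePrincipal a b) :=
  ⟨⟨fun S hS => ⟨fun c hc => (hc.1 S fun p hp => hS p hp c hc).1,
      fun c hc => (hc.1 S fun p hp => hS p hp c hc).2⟩, fun _ hc => hc.2⟩,
    fun c hc => le_iff.2 fun _ _ h => h c hc⟩

end CompleteLattice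

end LatticeCon

/-- `Princ L`: the set of principal congruences of the lattice `L`, ordered by inclusion. -/
abbrev Princ (L : Type u) [Lattice L] : Type u :=
  {c : LatticeCon L // ∃ a b : L, c = LatticeCon.principal a b}

/-- The set of principal complete congruences of the complete lattice `L`, ordered by
inclusion. -/
abbrev CompletePrinc (L : Type u) [CompleteLattice L] : Type u :=
  {c : LatticeCon L // ∃ a b : L, c = LatticeCon.completePrincipal a b}

/-! Each `p ∉ C` contributes a two-element interval from `({p}, ∅)` to `({p}, {p})`; for `p ∈ C` it
degenerates to a point. If `p < q`, collapsing the interval of `q` collapses that of `p`: after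
joining with `({p}, ∅)`, the downward closure of `hi` in `lo` puts `p` into `hi`. If `p ∈ C`, the
only such pair is `⊤`, and everything collapses.

Two isolated elements of `C` make every congruence with `⊥ ≁ ⊤` preserve `lo`: joining one of them
to almost any element gives `⊤`. Hence the congruences other than the full one are exactly the
`conOf H`, for lower sets `H` disjoint from `C` (`Separating.exists_eq_conOf`), and these are
visibly complete. A principal one is trivial or generated by the interval of a single `q`
(`exists_r_iff`), so it corresponds to a principal lower set.

Take `R` to be `P` without its bounds, plus two isolated elements of `C` and a three-element chain
whose least element is in `C`. The identity and the full congruence represent the bounds of `P`. The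
chain adds no principal congruence, but it secures length 5 even if `P` has only its bounds. -/

/-! ### The complete lattice of pairs. -/

/-- A pair `hi ⊆ lo` of subsets of a partially ordered set `R`. Either both are the whole of `R`,
or `lo` consists of at most two comparable elements, `hi` avoids the set `C`, and `hi` is closed
downwards in `lo`. -/
@[ext]
structure PairLattice {R : Type u} [PartialOrder R] (C : Set R) : Type u where
  lo : Set R
  hi : Set R
  hi_subset : hi ⊆ lo
  full_or : (∀ p, p ∈ hi) ∨ ((∃ s t, s ≤ t ∧ lo ⊆ {s, t}) ∧
    (∀ p ∈ lo, ∀ q ∈ hi, p < q → p ∈ hi) ∧ ∀ p ∈ hi, p ∉ C)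

namespace PairLattice

open Set

variable {R : Type u} [PartialOrder R] {C : Set R}

instance : PartialOrder (PairLattice C) :=
  PartialOrder.lift (fun x => (x.lo, x.hi)) fun _ _ h =>
    PairLattice.ext (congrArg Prod.fst h) (congrArg Prod.snd h)

theorem le_def {x y : PairLattice C} : x ≤ y ↔ x.lo ⊆ y.lo ∧ x.hi ⊆ y.hi := Iff.rfl

theorem lo_subset_lo {x y : PairLattice C} (h : x ≤ y) : x.lo ⊆ y.lo := h.1

theorem hi_subset_hi {x y : PairLattice C} (h : x ≤ y) : x.hi ⊆ y.hi := h.2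

theorem mem_hi_of_lt {x : PairLattice C} {p q : R} (hp : p ∈ x.lo) (hq : q ∈ x.hi)
    (h : p < q) : p ∈ x.hi := by
  rcases x.full_or with hf | ⟨-, h₂, -⟩
  · exact hf p
  · exact h₂ p hp q hq h

instance : InfSet (PairLattice C) where
  sInf S :=
    { lo := {p | ∀ x ∈ S, p ∈ x.lo}
      hi := {p | ∀ x ∈ S, p ∈ x.hi}
      hi_subset := fun p hp x hx => x.hi_subset (hp x hx)
      full_or := by
        -- A single member other than `⊤` already bounds `lo` and keeps `hi` away from `C`.
        by_cases h : ∀ x ∈ S, ∀ p, p ∈ x.hi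
        · exact Or.inl fun p x hx => h x hx p
        · push Not at h
          obtain ⟨x, hx, p, hp⟩ := h
          rcases x.full_or with hf | ⟨⟨s, t, hst, hsub⟩, -, h₃⟩
          · exact absurd (hf p) hp
          · exact Or.inr ⟨⟨s, t, hst, fun q hq => hsub (hq x hx)⟩,
              fun p hp q hq hpq y hy => mem_hi_of_lt (hp y hy) (hq y hy) hpq,
              fun p hp => h₃ p (hp x hx)⟩ }

theorem mem_lo_sInf {S : Set (PairLattice C)} {p : R} :
    p ∈ (sInf S).lo ↔ ∀ x ∈ S, p ∈ x.lo := Iff.rfl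

theorem mem_hi_sInf {S : Set (PairLattice C)} {p : R} :
    p ∈ (sInf S).hi ↔ ∀ x ∈ S, p ∈ x.hi := Iff.rfl

noncomputable instance : CompleteLattice (PairLattice C) :=
  completeLatticeOfInf _ fun _ =>
    ⟨fun x hx => le_def.2 ⟨fun _ hp => mem_lo_sInf.1 hp x hx, fun _ hp => mem_hi_sInf.1 hp x hx⟩,
      fun _ hy => le_def.2 ⟨fun _ hp => mem_lo_sInf.2 fun _ hx => (hy hx).1 hp,
        fun _ hp => mem_hi_sInf.2 fun _ hx => (hy hx).2 hp⟩⟩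

theorem mem_lo_biInf {ι : Type*} {S : Set ι} {f : ι → PairLattice C} {p : R} :
    p ∈ (⨅ i ∈ S, f i).lo ↔ ∀ i ∈ S, p ∈ (f i).lo := by
  rw [← sInf_image, mem_lo_sInf, forall_mem_image]

theorem mem_hi_biInf {ι : Type*} {S : Set ι} {f : ι → PairLattice C} {p : R} :
    p ∈ (⨅ i ∈ S, f i).hi ↔ ∀ i ∈ S, p ∈ (f i).hi := by
  rw [← sInf_image, mem_hi_sInf, forall_mem_image]

theorem mem_lo_inf {x y : PairLattice C} {p : R} :
    p ∈ (x ⊓ y).lo ↔ p ∈ x.lo ∧ p ∈ y.lo := by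
  rw [← sInf_pair, mem_lo_sInf]; simp

theorem mem_hi_inf {x y : PairLattice C} {p : R} :
    p ∈ (x ⊓ y).hi ↔ p ∈ x.hi ∧ p ∈ y.hi := by
  rw [← sInf_pair, mem_hi_sInf]; simp

theorem mem_hi_top (p : R) : p ∈ (⊤ : PairLattice C).hi := by
  rw [← sInf_empty, mem_hi_sInf]; simp

theorem mem_lo_top (p : R) : p ∈ (⊤ : PairLattice C).lo := hi_subset _ (mem_hi_top p)

theorem eq_top_of_forall {x : PairLattice C} (h : ∀ p, p ∈ x.hi) : x = ⊤ :=
  top_le_iff.1 ⟨fun p _ => x.hi_subset (h p), fun p _ => h p⟩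

theorem le_of_ne_top {x : PairLattice C} (hx : x ≠ ⊤) :
    ∃ s t, s ≤ t ∧ x.lo ⊆ {s, t} := by
  rcases x.full_or with hf | ⟨h, -, -⟩
  · exact absurd (eq_top_of_forall hf) hx
  · exact h

theorem notMem_of_ne_top {x : PairLattice C} (hx : x ≠ ⊤) {p : R} (hp : p ∈ x.hi) : p ∉ C := by
  rcases x.full_or with hf | ⟨-, -, h⟩
  · exact absurd (eq_top_of_forall hf) hx
  · exact h p hp

theorem comparable {x : PairLattice C} (hx : x ≠ ⊤) {p q : R} (hp : p ∈ x.lo) (hq : q ∈ x.lo) :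
    p ≤ q ∨ q ≤ p := by
  obtain ⟨s, t, hst, hsub⟩ := le_of_ne_top hx
  rcases hsub hp with rfl | rfl <;> rcases hsub hq with rfl | rfl <;> simp [hst]

theorem exists_greatest {x : PairLattice C} (hx : x ≠ ⊤) {A : Set R} (hA : A ⊆ x.lo)
    (hne : A.Nonempty) : ∃ q ∈ A, ∀ r ∈ A, r ≤ q := by
  obtain ⟨s, t, hst, hsub⟩ := le_of_ne_top hx
  obtain ⟨p, hp⟩ := hne
  by_cases ht : t ∈ A
  · refine ⟨t, ht, fun r hr => ?_⟩
    rcases hsub (hA hr) with rfl | rfl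
    · exact hst
    · exact le_rfl
  · have key : ∀ r ∈ A, r = s := fun r hr => by
      rcases hsub (hA hr) with h | h
      · exact h
      · exact absurd (h ▸ hr) ht
    exact ⟨p, hp, fun r hr => by rw [key r hr, key p hp]⟩

/-- The pair `({p}, ∅)`. -/
def bottomOf (C : Set R) (p : R) : PairLattice C where
  lo := {p}
  hi := ∅
  hi_subset := empty_subset _
  full_or := Or.inr ⟨⟨p, p, le_rfl, by simp⟩, by simp, by simp⟩

/-- The pair `({p}, {p} \ C)`. -/
def topOf (C : Set R) (p : R) : PairLattice C where
  lo := {p}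
  hi := {p} \ C
  hi_subset := sdiff_subset
  full_or := Or.inr ⟨⟨p, p, le_rfl, by simp⟩, by
    rintro q rfl r ⟨rfl, -⟩ h
    exact absurd h (lt_irrefl _), fun _ h => h.2⟩

theorem bottomOf_le {p : R} {x : PairLattice C} : bottomOf C p ≤ x ↔ p ∈ x.lo := by
  simp [le_def, bottomOf]

theorem topOf_le {p : R} (hp : p ∉ C) {x : PairLattice C} : topOf C p ≤ x ↔ p ∈ x.hi := by
  simp only [le_def, topOf, singleton_subset_iff]
  refine ⟨fun h => h.2 ⟨rfl, hp⟩, fun h => ⟨x.hi_subset h, ?_⟩⟩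
  rintro q ⟨rfl, -⟩
  exact h

theorem inf_topOf_of_mem_hi {p : R} {x : PairLattice C} (hp : p ∈ x.hi) :
    x ⊓ topOf C p = topOf C p := by
  refine inf_eq_right.2 ⟨?_, ?_⟩
  · rintro q rfl
    exact x.hi_subset hp
  · rintro q ⟨rfl, -⟩
    exact hp

theorem inf_topOf_of_notMem_hi {p : R} {x : PairLattice C} (hp : p ∈ x.lo) (hp' : p ∉ x.hi) :
    x ⊓ topOf C p = bottomOf C p := by
  ext q
  · rw [mem_lo_inf]
    simp only [topOf, bottomOf, mem_singleton_iff]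
    exact ⟨fun h => h.2, fun h => ⟨h ▸ hp, h⟩⟩
  · rw [mem_hi_inf]
    simp only [topOf, bottomOf, mem_sdiff, mem_singleton_iff, mem_empty_iff_false, iff_false]
    rintro ⟨h, rfl, -⟩
    exact hp' h

theorem inf_bottomOf_of_mem_lo {p : R} {x : PairLattice C} (hp : p ∈ x.lo) :
    x ⊓ bottomOf C p = bottomOf C p := inf_eq_right.2 (bottomOf_le.2 hp)

theorem lo_eq_empty_iff [Nonempty R] {x : PairLattice C} : x.lo = ∅ ↔ x = ⊥ := by
  constructor
  · intro h
    refine le_bot_iff.1 ⟨by simp [h], ?_⟩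
    exact x.hi_subset.trans (by simp [h])
  · rintro rfl
    let e : PairLattice C :=
      ⟨∅, ∅, Subset.rfl, Or.inr ⟨⟨Classical.arbitrary R, Classical.arbitrary R, le_rfl, by simp⟩,
        by simp, by simp⟩⟩
    exact subset_empty_iff.1 (show (⊥ : PairLattice C).lo ⊆ e.lo from (bot_le (a := e)).1)

theorem inf_bottomOf_of_notMem_lo [Nonempty R] {p : R} {x : PairLattice C} (hp : p ∉ x.lo) :
    x ⊓ bottomOf C p = ⊥ := by
  rw [← lo_eq_empty_iff]
  ext q
  rw [mem_lo_inf]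
  simp only [bottomOf, mem_singleton_iff, mem_empty_iff_false, iff_false]
  rintro ⟨h, rfl⟩
  exact hp h

/-! ### Complete congruences from lower sets. -/

/-- Enlarge `hi` by the elements of `H` that lie in `lo`. -/
def close (H : LowerSet R) (hH : Disjoint (H : Set R) C) (x : PairLattice C) : PairLattice C where
  lo := x.lo
  hi := x.hi ∪ (x.lo ∩ H)
  hi_subset := union_subset x.hi_subset inter_subset_left
  full_or := by
    rcases x.full_or with hf | ⟨h₁, h₂, h₃⟩
    · exact Or.inl fun p => Or.inl (hf p)
    · refine Or.inr ⟨h₁, ?_, ?_⟩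
      · rintro p hp q (hq | hq) hpq
        · exact Or.inl (h₂ p hp q hq hpq)
        · exact Or.inr ⟨hp, H.lower hpq.le hq.2⟩
      · rintro p (hp | hp)
        · exact h₃ p hp
        · exact disjoint_left.1 hH hp.2

section Close

variable {H : LowerSet R} {hH : Disjoint (H : Set R) C}

theorem le_close (x : PairLattice C) : x ≤ close H hH x :=
  ⟨Subset.rfl, subset_union_left⟩

theorem close_le_close {x y : PairLattice C} (h : x ≤ close H hH y) :
    close H hH x ≤ close H hH y :=
  ⟨h.1, union_subset h.2 fun _ hp => Or.inr ⟨h.1 hp.1, hp.2⟩⟩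

theorem close_eq_iff {x y : PairLattice C} :
    close H hH x = close H hH y ↔ x.lo = y.lo ∧ ∀ p, p ∉ H → (p ∈ x.hi ↔ p ∈ y.hi) := by
  constructor
  · intro h
    have h₁ : x.lo = y.lo := congrArg (fun x => x.lo) h
    refine ⟨h₁, fun p hp => ?_⟩
    have h₂ : x.hi ∪ (x.lo ∩ H) = y.hi ∪ (y.lo ∩ H) := congrArg (fun x => x.hi) h
    have := Set.ext_iff.1 h₂ p
    simpa [hp] using this
  · rintro ⟨h₁, h₂⟩
    refine PairLattice.ext h₁ (Set.ext fun p => ?_)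
    by_cases hp : p ∈ H
    · have hx := @hi_subset _ _ _ x p
      have hy := @hi_subset _ _ _ y p
      rw [← h₁] at hy
      simp only [close, mem_union, mem_inter_iff, SetLike.mem_coe, hp, ← h₁]
      tauto
    · simpa [close, hp] using h₂ p hp

/-- `close` is a closure operator, and the kernel of a closure operator respects arbitrary joins. -/
theorem close_iSup_le {ι : Type*} {S : Set ι} {f g : ι → PairLattice C}
    (h : ∀ i ∈ S, close H hH (f i) = close H hH (g i)) :
    close H hH (⨆ i ∈ S, f i) ≤ close H hH (⨆ i ∈ S, g i) := by
  refine close_le_close (iSup₂_le fun i hi => (le_close _).trans ((h i hi).le.trans ?_))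
  exact close_le_close ((le_iSup₂ (f := fun i (_ : i ∈ S) => g i) i hi).trans (le_close _))

end Close

theorem close_iSup {H : LowerSet R} {hH : Disjoint (H : Set R) C}
    {S : Set (PairLattice C × PairLattice C)}
    (h : ∀ i ∈ S, close H hH i.1 = close H hH i.2) :
    close H hH (⨆ i ∈ S, i.1) = close H hH (⨆ i ∈ S, i.2) :=
  le_antisymm (close_iSup_le h) (close_iSup_le fun i hi => (h i hi).symm)

/-- Meets are componentwise intersections, and the class of a pair is determined by `lo` and the
part of `hi` outside `H`. -/
theorem close_iInf {H : LowerSet R} {hH : Disjoint (H : Set R) C}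
    {S : Set (PairLattice C × PairLattice C)}
    (h : ∀ i ∈ S, close H hH i.1 = close H hH i.2) :
    close H hH (⨅ i ∈ S, i.1) = close H hH (⨅ i ∈ S, i.2) := by
  simp only [close_eq_iff] at h ⊢
  refine ⟨Set.ext fun p => ?_, fun p hp => ?_⟩
  · rw [mem_lo_biInf, mem_lo_biInf]
    exact forall₂_congr fun i hi => by rw [(h i hi).1]
  · rw [mem_hi_biInf, mem_hi_biInf]
    exact forall₂_congr fun i hi => (h i hi).2 p hp

/-- The congruence of `PairLattice C` that collapses `bottomOf C p` and `topOf C p` for `p ∈ H`. -/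
def conOf (H : LowerSet R) (hH : Disjoint (H : Set R) C) : LatticeCon (PairLattice C) where
  r x y := close H hH x = close H hH y
  iseqv := ⟨fun _ => rfl, Eq.symm, Eq.trans⟩
  inf {w x y z} h₁ h₂ := by
    have := close_iInf (hH := hH) (S := {(w, x), (y, z)}) (by simp [h₁, h₂])
    simpa only [iInf_pair] using this
  sup {w x y z} h₁ h₂ := by
    have := close_iSup (hH := hH) (S := {(w, x), (y, z)}) (by simp [h₁, h₂])
    simpa only [iSup_pair] using this

theorem conOf_r {H : LowerSet R} {hH : Disjoint (H : Set R) C} {x y : PairLattice C} :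
    (conOf H hH).r x y ↔ x.lo = y.lo ∧ ∀ p, p ∉ H → (p ∈ x.hi ↔ p ∈ y.hi) :=
  close_eq_iff

theorem isComplete_conOf (H : LowerSet R) (hH : Disjoint (H : Set R) C) :
    (conOf H hH).IsComplete := fun _ hS => ⟨close_iSup hS, close_iInf hS⟩

theorem conOf_bottomOf_topOf {H : LowerSet R} {hH : Disjoint (H : Set R) C} {p : R} (hp : p ∉ C) :
    (conOf H hH).r (bottomOf C p) (topOf C p) ↔ p ∈ H := by
  rw [conOf_r]
  constructor
  · intro h
    by_contra hpH
    simpa [bottomOf, topOf, hp] using h.2 p hpH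
  · intro h
    refine ⟨rfl, fun q hq => ?_⟩
    have : q ≠ p := by rintro rfl; exact hq h
    simp [bottomOf, topOf, this]

/-! ### Isolated elements force `lo` to be preserved. -/

theorem _root_.LatticeCon.r_of_bot_top {α : Type*} [Lattice α] [BoundedOrder α] {c : LatticeCon α}
    (h : c.r ⊥ ⊤) (x y : α) : c.r x y := by
  have key : ∀ z : α, c.r ⊥ z := fun z => by simpa using c.inf h (c.refl z)
  exact c.trans (c.symm (key x)) (key y)

/-- Below `⊤`, `lo` is a chain; if it contains the isolated `v`, it is `{v}`, and `v ∈ C` leaves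
`hi` empty. -/
theorem sup_bottomOf_eq_top [Nonempty R] {v : R} (hv : v ∈ C) (hv' : ∀ p, p ≤ v ∨ v ≤ p → p = v)
    {x : PairLattice C} (hx : x ≠ ⊥) (hxv : x ≠ bottomOf C v) : x ⊔ bottomOf C v = ⊤ := by
  by_contra h
  have hle : x ≤ x ⊔ bottomOf C v := le_sup_left
  have hmem : v ∈ (x ⊔ bottomOf C v).lo := bottomOf_le.1 le_sup_right
  have hlo : ∀ p ∈ x.lo, p = v := fun p hp => hv' p (comparable h (hle.1 hp) hmem)
  have hhi : ∀ p, p ∉ x.hi := fun p hp => by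
    have := hlo p (x.hi_subset hp)
    subst this
    exact notMem_of_ne_top h (hle.2 hp) hv
  obtain ⟨p, hp⟩ := nonempty_iff_ne_empty.2 (lo_eq_empty_iff.not.2 hx)
  obtain rfl := hlo p hp
  refine hxv (PairLattice.ext (Subset.antisymm hlo ?_) (eq_empty_of_forall_notMem hhi))
  rintro _ rfl
  exact hp

theorem bottomOf_ne_bot [Nonempty R] (p : R) : bottomOf C p ≠ ⊥ := by
  rw [Ne, ← lo_eq_empty_iff]
  exact singleton_ne_empty p

theorem bottomOf_injective : Function.Injective (bottomOf C) := fun _ _ h =>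
  singleton_injective (congrArg (fun x => x.lo) h)

/-- `v` and `w` are isolated elements of `R` that lie in `C`, and `v`, `w`, `z` are distinct. -/
structure Separating (C : Set R) (v w z : R) : Prop where
  left_mem : v ∈ C
  right_mem : w ∈ C
  left_isolated : ∀ p, p ≤ v ∨ v ≤ p → p = v
  right_isolated : ∀ p, p ≤ w ∨ w ≤ p → p = w
  left_ne_right : v ≠ w
  ne_left : z ≠ v
  ne_right : z ≠ w

namespace Separating

variable {v w z : R}

theorem symm (hs : Separating C v w z) : Separating C w v z :=
  ⟨hs.2, hs.1, hs.4, hs.3, hs.5.symm, hs.7, hs.6⟩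

variable {c : LatticeCon (PairLattice C)}

theorem r_bottomOf_top (hs : Separating C v w z) {x : PairLattice C} (hx : x ≠ ⊥)
    (hxv : x ≠ bottomOf C v) (h : c.r ⊥ x) : c.r (bottomOf C v) ⊤ := by
  have : Nonempty R := ⟨v⟩
  have := c.sup h (c.refl (bottomOf C v))
  rwa [sup_bottomOf_eq_top hs.left_mem hs.left_isolated hx hxv, bot_sup_eq] at this

theorem r_bot_bottomOf {p q : R} (hpq : p ≠ q) (h : c.r (bottomOf C p) ⊤) :
    c.r ⊥ (bottomOf C q) := by
  have : Nonempty R := ⟨p⟩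
  have := c.inf h (c.refl (bottomOf C q))
  rwa [inf_bottomOf_of_notMem_lo (by simpa [bottomOf] using hpq.symm), top_inf_eq] at this

/-- Joining with `w` gives `({w}, ∅) ~ ⊤`, meeting with `z` gives `⊥ ~ ({z}, ∅)`, and joining with
`v` gives `({v}, ∅) ~ ⊤`. The third element `z` is what lets the argument return to `v`. -/
theorem full_of_r_bot_left (hs : Separating C v w z) (h : c.r ⊥ (bottomOf C v)) : c.r ⊥ ⊤ := by
  have : Nonempty R := ⟨v⟩
  have h₁ := hs.symm.r_bottomOf_top (bottomOf_ne_bot v) (bottomOf_injective.ne hs.left_ne_right) h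
  have h₂ := r_bot_bottomOf hs.ne_right.symm h₁
  exact c.trans h (hs.r_bottomOf_top (bottomOf_ne_bot z) (bottomOf_injective.ne hs.ne_left) h₂)

theorem full_of_r_bot (hs : Separating C v w z) {x : PairLattice C} (hx : x ≠ ⊥)
    (h : c.r ⊥ x) : c.r ⊥ ⊤ := by
  by_cases hxv : x = bottomOf C v
  · exact hs.full_of_r_bot_left (hxv ▸ h)
  · exact hs.symm.full_of_r_bot_left
      (r_bot_bottomOf hs.left_ne_right (hs.r_bottomOf_top hx hxv h))

theorem full_of_r_of_mem (hs : Separating C v w z) {x y : PairLattice C} {p : R}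
    (hx : p ∈ x.lo) (hy : p ∉ y.lo) (h : c.r x y) : c.r ⊥ ⊤ := by
  have : Nonempty R := ⟨v⟩
  have := c.inf h (c.refl (bottomOf C p))
  rw [inf_bottomOf_of_mem_lo hx, inf_bottomOf_of_notMem_lo hy] at this
  exact hs.full_of_r_bot (bottomOf_ne_bot p) (c.symm this)

/-- The incomparable `v` and `w` cannot both lie in `x.lo`, so `lo` would change at one of them. -/
theorem full_of_r_top (hs : Separating C v w z) {x : PairLattice C} (hx : x ≠ ⊤)
    (h : c.r ⊤ x) : c.r ⊥ ⊤ := by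
  by_cases hv : v ∈ x.lo
  · refine hs.full_of_r_of_mem (mem_lo_top w) (fun hw => hs.left_ne_right ?_) h
    exact (hs.left_isolated w (comparable hx hw hv)).symm
  · exact hs.full_of_r_of_mem (mem_lo_top v) hv h

theorem lo_eq_of_r (hs : Separating C v w z) (hc : ¬ c.r ⊥ ⊤) {x y : PairLattice C}
    (h : c.r x y) : x.lo = y.lo := by
  refine Subset.antisymm (fun p hx => ?_) (fun p hy => ?_)
  · by_contra hy
    exact hc (hs.full_of_r_of_mem hx hy h)
  · by_contra hx
    exact hc (hs.full_of_r_of_mem hy hx (c.symm h))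

end Separating

/-! ### Description of all congruences. -/

/-- The pair `({p, q}, ∅)` for `p ≤ q`. -/
def bottomPair (C : Set R) {p q : R} (h : p ≤ q) : PairLattice C where
  lo := {p, q}
  hi := ∅
  hi_subset := empty_subset _
  full_or := Or.inr ⟨⟨p, q, h, Subset.rfl⟩, by simp, by simp⟩

namespace Separating

variable {v w z : R} {c : LatticeCon (PairLattice C)}

/-- Joining with `bottomOf C p` leaves `hi` empty on the lower side, while on the upper side `q ∈
hi` drags `p` into `hi`. For `p ∈ C` this makes the upper side `⊤`; otherwise a meet with `topOf C
p` isolates the interval of `p`. -/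
theorem collapse_of_lt (hs : Separating C v w z) (hc : ¬ c.r ⊥ ⊤) {p q : R} (hpq : p < q)
    (hq : q ∉ C) (h : c.r (bottomOf C q) (topOf C q)) :
    p ∉ C ∧ c.r (bottomOf C p) (topOf C p) := by
  have h' := c.sup h (c.refl (bottomOf C p))
  set x := bottomOf C q ⊔ bottomOf C p
  set y := topOf C q ⊔ bottomOf C p
  have hxle : x ≤ bottomPair C hpq.le :=
    sup_le (bottomOf_le.2 (by simp [bottomPair])) (bottomOf_le.2 (by simp [bottomPair]))
  have hxlo : p ∈ x.lo := bottomOf_le.1 le_sup_right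
  have hxhi : p ∉ x.hi := fun hp => hxle.2 hp
  have hyhi : p ∈ y.hi :=
    mem_hi_of_lt (bottomOf_le.1 le_sup_right) ((topOf_le hq).1 le_sup_left) hpq
  refine ⟨fun hp => hc ?_, ?_⟩
  · have hy : y = ⊤ := by
      by_contra hy
      exact notMem_of_ne_top hy hyhi hp
    rw [hy] at h'
    refine hs.full_of_r_top ?_ (c.symm h')
    intro hx
    exact hxhi (hx ▸ mem_hi_top p)
  · have := c.inf h' (c.refl (topOf C p))
    rwa [inf_topOf_of_mem_hi hyhi, inf_topOf_of_notMem_hi hxlo hxhi] at this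

/-- The set of those `p ∉ C` for which `bottomOf C p` and `topOf C p` are congruent. -/
def collapsed (hs : Separating C v w z) (hc : ¬ c.r ⊥ ⊤) : LowerSet R where
  carrier := {p | p ∉ C ∧ c.r (bottomOf C p) (topOf C p)}
  lower' q p hpq hq := by
    rcases hpq.lt_or_eq with h | rfl
    · exact hs.collapse_of_lt hc h hq.1 hq.2
    · exact hq

theorem disjoint_collapsed (hs : Separating C v w z) (hc : ¬ c.r ⊥ ⊤) :
    Disjoint (hs.collapsed hc : Set R) C :=
  disjoint_left.2 fun _ hp => hp.1

end Separating

/-- Take `q` greatest in `y.hi \ x.hi`. Meeting with `topOf C q` recovers the interval of `q`;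
conversely `x ⊔ topOf C q = y`, as downward closure supplies the rest of `y.hi`. Since `q` does not
depend on `c`, this compares different congruences on the same pair. -/
theorem exists_r_iff {x y : PairLattice C} (hxy : x ≤ y) (hlo : x.lo = y.lo) (hne : x ≠ y)
    (hy : y ≠ ⊤) : ∃ q, q ∉ C ∧
      ∀ c : LatticeCon (PairLattice C), c.r x y ↔ c.r (bottomOf C q) (topOf C q) := by
  have hdiff : (y.hi \ x.hi).Nonempty := by
    rw [nonempty_iff_ne_empty, Ne, sdiff_eq_empty]
    exact fun h => hne (PairLattice.ext hlo (Subset.antisymm hxy.2 h))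
  obtain ⟨q, ⟨hqy, hqx⟩, hmax⟩ :=
    exists_greatest hy (sdiff_subset.trans y.hi_subset) hdiff
  have hqC : q ∉ C := notMem_of_ne_top hy hqy
  have hqlo : q ∈ x.lo := hlo ▸ y.hi_subset hqy
  refine ⟨q, hqC, fun c => ⟨fun h => ?_, fun h => ?_⟩⟩
  · have := c.inf h (c.refl (topOf C q))
    rwa [inf_topOf_of_mem_hi hqy, inf_topOf_of_notMem_hi hqlo hqx] at this
  · have h' := c.sup (c.refl x) h
    have h₁ : x ⊔ bottomOf C q = x := sup_eq_left.2 (bottomOf_le.2 hqlo)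
    have h₂ : x ⊔ topOf C q = y := by
      refine le_antisymm (sup_le hxy ((topOf_le hqC).2 hqy)) ?_
      have hle : x ≤ x ⊔ topOf C q := le_sup_left
      refine le_def.2 ⟨hlo ▸ lo_subset_lo hle, fun r hr => ?_⟩
      by_cases hrx : r ∈ x.hi
      · exact hle.2 hrx
      · have hqm : q ∈ (x ⊔ topOf C q).hi := (topOf_le hqC).1 le_sup_right
        rcases (hmax r ⟨hr, hrx⟩).lt_or_eq with h | rfl
        · exact mem_hi_of_lt (lo_subset_lo hle (hlo ▸ y.hi_subset hr)) hqm h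
        · exact hqm
    rwa [h₁, h₂] at h'

theorem not_conOf_bot_top [Nonempty R] {H : LowerSet R} {hH : Disjoint (H : Set R) C} :
    ¬ (conOf H hH).r ⊥ ⊤ := fun h => by
  have p := Classical.arbitrary R
  have := mem_lo_top (C := C) p
  rw [← (conOf_r.1 h).1, lo_eq_empty_iff.2 rfl] at this
  exact this

theorem Separating.exists_eq_conOf {v w z : R} (hs : Separating C v w z)
    {c : LatticeCon (PairLattice C)} (hc : ¬ c.r ⊥ ⊤) :
    ∃ (H : LowerSet R) (hH : Disjoint (H : Set R) C), c = conOf H hH := by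
  have : Nonempty R := ⟨v⟩
  refine ⟨hs.collapsed hc, hs.disjoint_collapsed hc, le_antisymm ?_ ?_⟩
  · have key : ∀ x y : PairLattice C, c.r x y → ∀ p ∉ hs.collapsed hc, p ∈ x.hi → p ∈ y.hi := by
      intro x y h p hp hx
      by_contra hy
      have hytop : y ≠ ⊤ := by rintro rfl; exact hy (mem_hi_top p)
      have hxtop : x ≠ ⊤ := by
        rintro rfl
        exact hc (hs.full_of_r_top hytop h)
      have := c.inf h (c.refl (topOf C p))
      rw [inf_topOf_of_mem_hi hx,
        inf_topOf_of_notMem_hi (hs.lo_eq_of_r hc h ▸ x.hi_subset hx) hy] at this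
      exact hp ⟨notMem_of_ne_top hxtop hx, c.symm this⟩
    exact LatticeCon.le_iff.2 fun x y h => conOf_r.2 ⟨hs.lo_eq_of_r hc h,
      fun p hp => ⟨key x y h p hp, key y x (c.symm h) p hp⟩⟩
  · refine LatticeCon.le_iff.2 fun x y h => ?_
    -- Passing to meet and join gives comparable elements, so that a single `q` decides the matter
    -- for both congruences.
    rw [← LatticeCon.r_inf_sup_iff] at h ⊢
    by_cases hne : x ⊓ y = x ⊔ y
    · rw [hne]
    have hytop : x ⊔ y ≠ ⊤ := fun htop => not_conOf_bot_top <|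
      hs.full_of_r_top (htop ▸ hne) (Setoid.symm' _ (htop ▸ h))
    obtain ⟨q, hqC, hq⟩ := exists_r_iff inf_le_sup (conOf_r.1 h).1 hne hytop
    exact (hq c).2 (((conOf_bottomOf_topOf hqC).1 ((hq _).1 h)).2)

/-- The congruence that identifies all elements. -/
def _root_.LatticeCon.full (α : Type*) [Lattice α] : LatticeCon α where
  r _ _ := True
  iseqv := ⟨fun _ => trivial, fun _ => trivial, fun _ _ => trivial⟩
  inf _ _ := trivial
  sup _ _ := trivial

theorem _root_.LatticeCon.eq_full {α : Type u} [Lattice α] [BoundedOrder α] {c : LatticeCon α}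
    (h : c.r ⊥ ⊤) : c = LatticeCon.full α :=
  le_antisymm (LatticeCon.le_iff.2 fun _ _ _ => trivial)
    (LatticeCon.le_iff.2 fun x y _ => LatticeCon.r_of_bot_top h x y)

theorem Separating.isComplete {v w z : R} (hs : Separating C v w z)
    (c : LatticeCon (PairLattice C)) : c.IsComplete := by
  by_cases hc : c.r ⊥ ⊤
  · exact fun S _ => ⟨LatticeCon.r_of_bot_top hc _ _, LatticeCon.r_of_bot_top hc _ _⟩
  · obtain ⟨H, hH, rfl⟩ := hs.exists_eq_conOf hc
    exact isComplete_conOf H hH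

/-! ### Finiteness and length. -/

theorem finite [Finite R] : Finite (PairLattice C) :=
  Finite.of_injective (fun x : PairLattice C => (x.lo, x.hi)) fun _ _ h =>
    PairLattice.ext (congrArg Prod.fst h) (congrArg Prod.snd h)

theorem lo_finite {x : PairLattice C} (hx : x ≠ ⊤) : x.lo.Finite := by
  obtain ⟨s, t, -, h⟩ := le_of_ne_top hx
  exact (toFinite {s, t}).subset h

theorem ncard_lo_le {x : PairLattice C} (hx : x ≠ ⊤) : x.lo.ncard ≤ 2 := by
  obtain ⟨s, t, -, h⟩ := le_of_ne_top hx
  exact (ncard_le_ncard h).trans (ncard_insert_le s {t} |>.trans (by simp))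

theorem card_lt_card {x y : PairLattice C} (hy : y ≠ ⊤) (h : x < y) :
    x.lo.ncard + x.hi.ncard < y.lo.ncard + y.hi.ncard := by
  have hf := lo_finite hy
  have hf' := hf.subset y.hi_subset
  have h₁ := ncard_le_ncard (lo_subset_lo h.le) hf
  have h₂ := ncard_le_ncard (hi_subset_hi h.le) hf'
  by_contra hcon
  exact h.ne (PairLattice.ext (eq_of_subset_of_ncard_le (lo_subset_lo h.le) (by omega) hf)
    (eq_of_subset_of_ncard_le (hi_subset_hi h.le) (by omega) hf'))

theorem card_le {x : PairLattice C} (hx : x ≠ ⊤) : x.lo.ncard + x.hi.ncard ≤ 4 := by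
  have h₁ := ncard_lo_le hx
  have h₂ := ncard_le_ncard x.hi_subset (lo_finite hx)
  omega

theorem krullDim_le : Order.krullDim (PairLattice C) ≤ 5 := by
  classical
  -- The total size of `lo` and `hi` is a strictly monotone rank of at most 4 below `⊤`. The value
  -- at `⊤` is set by hand, since `ncard` vanishes on infinite sets.
  let f : PairLattice C → Fin 6 := fun x =>
    if hx : x = ⊤ then 5 else ⟨x.lo.ncard + x.hi.ncard, (card_le hx).trans_lt (by norm_num)⟩
  have hf : StrictMono f := fun x y hxy => by
    have hx : x ≠ ⊤ := hxy.ne_top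
    by_cases hy : y = ⊤
    · simp only [f, hx, hy, dif_neg, dif_pos, not_false_eq_true]
      exact Fin.lt_def.2 (Nat.lt_succ_of_le (card_le hx))
    · simp only [f, hx, hy, dif_neg, not_false_eq_true]
      exact Fin.lt_def.2 (card_lt_card hy hxy)
  refine (Order.krullDim_le_of_strictMono f hf).trans (iSup_le fun s => ?_)
  have := s.length_lt_card
  rw [Fintype.card_fin] at this
  exact_mod_cast Nat.lt_succ_iff.1 this

/-- The pair `({p, q}, {p})` for `p < q` and `p ∉ C`. -/
def middlePair {p q : R} (h : p < q) (hp : p ∉ C) : PairLattice C where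
  lo := {p, q}
  hi := {p}
  hi_subset := by simp
  full_or := Or.inr ⟨⟨p, q, h.le, Subset.rfl⟩, by
    rintro r (rfl | rfl) _ rfl hr
    · rfl
    · exact absurd hr h.asymm, by simpa⟩

/-- The pair `({p, q}, {p, q})` for `p < q` and `p, q ∉ C`. -/
def topPair {p q : R} (h : p < q) (hp : p ∉ C) (hq : q ∉ C) : PairLattice C where
  lo := {p, q}
  hi := {p, q}
  hi_subset := Subset.rfl
  full_or := Or.inr ⟨⟨p, q, h.le, Subset.rfl⟩, fun _ hr _ _ _ => hr, by simp [hp, hq]⟩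

theorem le_krullDim {p q r : R} (h : p < q) (hp : p ∉ C) (hq : q ∉ C) (hr : r ∈ C) :
    5 ≤ Order.krullDim (PairLattice C) := by
  have : Nonempty R := ⟨p⟩
  have h₀ : (⊥ : PairLattice C) < bottomOf C q := bot_lt_iff_ne_bot.2 (bottomOf_ne_bot q)
  have h₁ : bottomOf C q < bottomPair C h.le :=
    lt_of_le_not_ge (bottomOf_le.2 (by simp [bottomPair])) fun hle =>
      h.ne (by simpa [bottomPair, bottomOf] using hle.1 (by simp [bottomPair] : p ∈ _))
  have h₂ : bottomPair C h.le < middlePair h hp :=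
    lt_of_le_not_ge (le_def.2 ⟨Subset.rfl, empty_subset _⟩) fun hle =>
      (hle.2 (mem_singleton p) : p ∈ (∅ : Set R))
  have h₃ : middlePair h hp < topPair h hp hq :=
    lt_of_le_not_ge (le_def.2 ⟨Subset.rfl, by simp [middlePair, topPair]⟩) fun hle =>
      h.ne' (hle.2 (by simp [topPair] : q ∈ _))
  have h₄ : topPair h hp hq < ⊤ := lt_top_iff_ne_top.2 fun htop => by
    have : r ∈ (topPair h hp hq).hi := htop ▸ mem_hi_top r
    rcases this with rfl | rfl <;> contradiction
  let s : LTSeries (PairLattice C) := LTSeries.mk 5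
    ![⊥, bottomOf C q, bottomPair C h.le, middlePair h hp, topPair h hp hq, ⊤]
    (Fin.strictMono_iff_lt_succ.2 fun i => by fin_cases i <;> assumption)
  have hs : s.length = 5 := rfl
  have := Order.LTSeries.length_le_krullDim s
  rw [hs] at this
  exact_mod_cast this

/-! ### The extended poset and the representation of `P`. -/

/-- The poset `Q` together with a disjoint three-element chain and two isolated elements. -/
abbrev Extended (Q : Type u) : Type u := Q ⊕ (Fin 3 ⊕ (Unit ⊕ Unit))

/-- The least element of the added chain and the two added isolated elements. -/
def caps (Q : Type u) : Set (Extended Q) :=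
  {.inr (.inl 0), .inr (.inr (.inl ())), .inr (.inr (.inr ()))}

theorem separating_caps (Q : Type u) [PartialOrder Q] :
    Separating (caps Q) (.inr (.inr (.inl ()))) (.inr (.inr (.inr ()))) (.inr (.inl 0)) where
  left_mem := by simp [caps]
  right_mem := by simp [caps]
  left_isolated := by rintro (p | p | p | p) <;> simp
  right_isolated := by rintro (p | p | p | p) <;> simp
  left_ne_right := by simp
  ne_left := by simp
  ne_right := by simp

/-- A lower set that meets the added chain contains its least element, which is in `caps Q`. So the
chain yields no congruences beyond the full one. -/
theorem mem_range_inl_of_disjoint {Q : Type u} [PartialOrder Q] {H : LowerSet (Extended Q)}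
    (hH : Disjoint (H : Set (Extended Q)) (caps Q)) {r : Extended Q} (hr : r ∈ H) :
    ∃ q, r = .inl q := by
  rw [disjoint_left] at hH
  rcases r with q | k | k | k
  · exact ⟨q, rfl⟩
  · exact absurd (by simp [caps]) (hH (H.lower (show Sum.inr (Sum.inl 0) ≤ _ by simp) hr))
  · exact absurd (by simp [caps]) (hH hr)
  · exact absurd (by simp [caps]) (hH hr)

theorem inl_notMem_caps {Q : Type u} (q : Q) : (.inl q : Extended Q) ∉ caps Q := by
  simp [caps]

variable {P : Type u} [PartialOrder P] [BoundedOrder P]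

/-- The elements of `P` other than the bounds. -/
abbrev Inner (P : Type u) [PartialOrder P] [BoundedOrder P] : Type u := {p : P // p ≠ ⊥ ∧ p ≠ ⊤}

/-- The elements of `Inner P` below `p`, as a lower set of the extended poset. -/
def below (p : P) : LowerSet (Extended (Inner P)) where
  carrier := {r | ∃ q : Inner P, r = .inl q ∧ (q : P) ≤ p}
  lower' := by
    rintro _ (r | r) hr ⟨q, rfl, hq⟩
    · exact ⟨r, rfl, le_trans (Subtype.coe_le_coe.2 (Sum.inl_le_inl_iff.1 hr)) hq⟩
    · simp at hr

theorem inl_mem_below {p : P} {q : Inner P} : .inl q ∈ below p ↔ (q : P) ≤ p :=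
  ⟨fun ⟨_, h, hq⟩ => Sum.inl_injective h ▸ hq, fun h => ⟨q, rfl, h⟩⟩

theorem disjoint_below (p : P) :
    Disjoint (below p : Set (Extended (Inner P))) (caps (Inner P)) :=
  disjoint_left.2 fun _ ⟨q, h, _⟩ => h ▸ inl_notMem_caps q

open Classical in
/-- The congruence that represents `p`. -/
noncomputable def conOfElement (p : P) : LatticeCon (PairLattice (caps (Inner P))) :=
  -- `below ⊤` is all of `Inner P` and would only give a proper congruence.
  if p = ⊤ then LatticeCon.full _ else conOf (below p) (disjoint_below p)

theorem conOfElement_top : conOfElement (⊤ : P) = LatticeCon.full _ := if_pos rfl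

theorem conOfElement_of_ne_top {p : P} (hp : p ≠ ⊤) :
    conOfElement p = conOf (below p) (disjoint_below p) := if_neg hp

theorem conOfElement_bot_top {p : P} : (conOfElement p).r ⊥ ⊤ ↔ p = ⊤ := by
  have : Nonempty (Extended (Inner P)) := ⟨.inr (.inl 0)⟩
  by_cases hp : p = ⊤
  · subst hp
    exact iff_of_true (conOfElement_top (P := P) ▸ trivial) rfl
  · rw [conOfElement_of_ne_top hp]
    exact iff_of_false not_conOf_bot_top hp

theorem conOfElement_inl {p : P} {q : Inner P} :
    (conOfElement p).r (bottomOf _ (.inl q)) (topOf _ (.inl q)) ↔ (q : P) ≤ p := by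
  by_cases hp : p = ⊤
  · subst hp
    exact iff_of_true (conOfElement_top (P := P) ▸ trivial) le_top
  · rw [conOfElement_of_ne_top hp, conOf_bottomOf_topOf (inl_notMem_caps q), inl_mem_below]

theorem conOfElement_inner_le {q : Inner P} {c : LatticeCon (PairLattice (caps (Inner P)))}
    (h : c.r (bottomOf _ (.inl q)) (topOf _ (.inl q))) : conOfElement (q : P) ≤ c := by
  by_cases hc : c.r ⊥ ⊤
  · exact LatticeCon.le_iff.2 fun x y _ => LatticeCon.r_of_bot_top hc x y
  · obtain ⟨H, hH, rfl⟩ := (separating_caps _).exists_eq_conOf hc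
    rw [conOf_bottomOf_topOf (inl_notMem_caps q)] at h
    rw [conOfElement_of_ne_top q.2.2]
    refine LatticeCon.le_iff.2 fun x y hxy => ?_
    rw [conOf_r] at hxy ⊢
    refine ⟨hxy.1, fun p hp => hxy.2 p fun hpq => hp ?_⟩
    obtain ⟨r, rfl, hr⟩ := hpq
    exact H.lower (Sum.inl_le_inl_iff.2 hr) h

theorem conOfElement_bot [Nontrivial P] {x y : PairLattice (caps (Inner P))} :
    (conOfElement (⊥ : P)).r x y ↔ x = y := by
  refine ⟨fun h => ?_, fun h => h ▸ Setoid.refl' _ x⟩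
  rw [conOfElement_of_ne_top bot_ne_top, conOf_r] at h
  refine PairLattice.ext h.1 (Set.ext fun p => h.2 p ?_)
  rintro ⟨q, rfl, hq⟩
  exact q.2.1 (le_bot_iff.1 hq)

theorem conOfElement_bot_le [Nontrivial P] (c : LatticeCon (PairLattice (caps (Inner P)))) :
    conOfElement (⊥ : P) ≤ c :=
  LatticeCon.le_iff.2 fun x _ h => conOfElement_bot.1 h ▸ Setoid.refl' _ x

theorem conOfElement_le_iff [Nontrivial P] {p q : P} :
    conOfElement p ≤ conOfElement q ↔ p ≤ q := by
  by_cases hp : p = ⊤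
  · subst hp
    rw [top_le_iff, ← conOfElement_bot_top]
    refine ⟨fun h => LatticeCon.le_iff.1 h _ _ (conOfElement_bot_top.2 rfl), fun h => ?_⟩
    exact LatticeCon.le_iff.2 fun x y _ => LatticeCon.r_of_bot_top h x y
  by_cases hp' : p = ⊥
  · subst hp'
    exact iff_of_true (conOfElement_bot_le _) bot_le
  let r : Inner P := ⟨p, hp', hp⟩
  exact ⟨fun h => conOfElement_inl.1 (LatticeCon.le_iff.1 h _ _
      ((conOfElement_inl (q := r)).2 le_rfl)),
    fun h => conOfElement_inner_le (q := r) (conOfElement_inl.2 h)⟩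

theorem exists_eq_principal [Nontrivial P] (p : P) :
    ∃ x y, conOfElement p = LatticeCon.principal x y := by
  suffices h : ∃ x y, (conOfElement p).r x y ∧
      ∀ c : LatticeCon (PairLattice (caps (Inner P))), c.r x y → conOfElement p ≤ c by
    obtain ⟨x, y, hxy, hle⟩ := h
    have hl := LatticeCon.isLeast_principal x y
    exact ⟨x, y, le_antisymm (hle _ hl.1) (hl.2 hxy)⟩
  by_cases hp : p = ⊤
  · exact ⟨⊥, ⊤, conOfElement_bot_top.2 hp, fun c hc =>
      LatticeCon.le_iff.2 fun x y _ => LatticeCon.r_of_bot_top hc x y⟩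
  by_cases hp' : p = ⊥
  · subst hp'
    exact ⟨⊥, ⊥, Setoid.refl' _ _, fun c _ => conOfElement_bot_le c⟩
  let r : Inner P := ⟨p, hp', hp⟩
  exact ⟨_, _, (conOfElement_inl (q := r)).2 le_rfl, fun c hc => conOfElement_inner_le (q := r) hc⟩

/-- The generator `q` from `exists_r_iff` is collapsed by a proper congruence, hence it comes from
`Inner P`. -/
theorem exists_conOfElement_eq [Nontrivial P] (x y : PairLattice (caps (Inner P))) :
    ∃ p : P, conOfElement p = LatticeCon.principal x y := by
  obtain ⟨hmem, hle⟩ := LatticeCon.isLeast_principal x y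
  set c := LatticeCon.principal x y
  by_cases hc : c.r ⊥ ⊤
  · exact ⟨⊤, conOfElement_top.trans (LatticeCon.eq_full hc).symm⟩
  have hs := separating_caps (Inner P)
  have h : c.r (x ⊓ y) (x ⊔ y) := LatticeCon.r_inf_sup_iff c |>.2 hmem
  by_cases hne : x ⊓ y = x ⊔ y
  · refine ⟨⊥, le_antisymm (conOfElement_bot_le c) (hle ?_)⟩
    exact conOfElement_bot.2 (inf_eq_sup.1 hne)
  have htop : x ⊔ y ≠ ⊤ := fun htop =>
    hc (hs.full_of_r_top (htop ▸ hne) (Setoid.symm' _ (htop ▸ h)))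
  obtain ⟨q, hqC, hq⟩ := exists_r_iff inf_le_sup (hs.lo_eq_of_r hc h) hne htop
  have hqc := (hq c).1 h
  obtain ⟨r, rfl⟩ := mem_range_inl_of_disjoint (hs.disjoint_collapsed hc)
    (show q ∈ hs.collapsed hc from ⟨hqC, hqc⟩)
  refine ⟨r, le_antisymm (conOfElement_inner_le hqc) (hle ?_)⟩
  have := (hq (conOfElement (r : P))).2 (conOfElement_inl.2 le_rfl)
  exact (LatticeCon.r_inf_sup_iff _).1 this

theorem nonempty_orderIso_princ [Nontrivial P] :
    Nonempty (P ≃o Princ (PairLattice (caps (Inner P)))) := by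
  let f : P ↪o Princ (PairLattice (caps (Inner P))) :=
    OrderEmbedding.ofMapLEIff (fun p => ⟨conOfElement p, exists_eq_principal p⟩)
      fun _ _ => conOfElement_le_iff
  refine ⟨RelIso.ofSurjective f ?_⟩
  rintro ⟨_, x, y, rfl⟩
  obtain ⟨p, hp⟩ := exists_conOfElement_eq (P := P) x y
  exact ⟨p, Subtype.ext hp⟩

end PairLattice

/-! ### Complete principal congruences, the one-element case and the conclusion. -/

theorem LatticeCon.completePrincipal_eq_principal {α : Type u} [CompleteLattice α]
    (h : ∀ c : LatticeCon α, c.IsComplete) (a b : α) :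
    completePrincipal a b = principal a b :=
  le_antisymm ((isLeast_completePrincipal a b).2 ⟨h _, (isLeast_principal a b).1⟩)
    ((isLeast_principal a b).2 (isLeast_completePrincipal a b).1.2)

theorem nonempty_orderIso_completePrinc {P α : Type u} [LE P] [CompleteLattice α]
    (h : ∀ c : LatticeCon α, c.IsComplete) (e : Nonempty (P ≃o Princ α)) :
    Nonempty (P ≃o CompletePrinc α) := by
  have hp : (fun c : LatticeCon α => ∃ a b, c = LatticeCon.completePrincipal a b) =
      fun c => ∃ a b, c = LatticeCon.principal a b := by
    simp only [LatticeCon.completePrincipal_eq_principal h]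
  unfold CompletePrinc
  rwa [hp]

theorem nonempty_orderIso_princ_of_subsingleton {P α : Type u} [PartialOrder P] [Nonempty P]
    [Subsingleton P] [Lattice α] [Nonempty α] [Subsingleton α] :
    Nonempty (P ≃o Princ α) := by
  have hr : ∀ (c : LatticeCon α) (x y : α), c.r x y := fun c x y =>
    Subsingleton.elim x y ▸ Setoid.refl' _ x
  have a := Classical.arbitrary α
  have p := Classical.arbitrary P
  have hsub : ∀ c d : Princ α, c ≤ d := fun c d => LatticeCon.le_iff.2 fun x y _ => hr _ x y
  exact ⟨{ toFun := fun _ => ⟨LatticeCon.principal a a, a, a, rfl⟩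
           invFun := fun _ => p
           left_inv := fun _ => Subsingleton.elim _ _
           right_inv := fun c => le_antisymm (hsub _ c) (hsub c _)
           map_rel_iff' := fun {x y} => iff_of_true (hsub _ _) (Subsingleton.elim x y).le }⟩

theorem theorem2 (P : Type u) [PartialOrder P] [BoundedOrder P] :
    ∃ (K : Type u) (_ : CompleteLattice K),
      Nonempty (P ≃o Princ K) ∧
      (Finite P → Finite K) ∧
      Order.krullDim K ≤ 5 ∧
      (Nontrivial P → Order.krullDim K = 5) ∧
      (∀ c : LatticeCon K, c.IsComplete) ∧
      Nonempty (P ≃o CompletePrinc K) := by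
  rcases subsingleton_or_nontrivial P with hP | hP
  -- When the bounds of `P` coincide, the identity and the full congruence must too, so a
  -- one-element lattice is used.
  · have hc : ∀ c : LatticeCon PUnit.{u + 1}, c.IsComplete := fun c S _ =>
      ⟨c.refl _, c.refl _⟩
    have e : Nonempty (P ≃o Princ PUnit.{u + 1}) := nonempty_orderIso_princ_of_subsingleton
    refine ⟨PUnit, inferInstance, e, fun _ => inferInstance, ?_,
      fun h => absurd hP (not_subsingleton P), hc, nonempty_orderIso_completePrinc hc e⟩
    rw [Order.krullDim_eq_zero_of_unique]
    norm_num
  · have hs := PairLattice.separating_caps (PairLattice.Inner P)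
    refine ⟨PairLattice (PairLattice.caps (PairLattice.Inner P)), inferInstance,
      PairLattice.nonempty_orderIso_princ, fun _ => PairLattice.finite, PairLattice.krullDim_le,
      fun _ => le_antisymm PairLattice.krullDim_le ?_, hs.isComplete,
      nonempty_orderIso_completePrinc hs.isComplete PairLattice.nonempty_orderIso_princ⟩
    -- The two upper elements of the added chain avoid `caps` and are available for every `P`.
    exact PairLattice.le_krullDim (p := .inr (.inl 1)) (q := .inr (.inl 2))
      (Sum.inr_lt_inr_iff.2 (Sum.inl_lt_inl_iff.2 (by decide))) (by simp [PairLattice.caps])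
      (by simp [PairLattice.caps]) hs.left_mem
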